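/- Let $X$ and $Y$ be Banach spaces, both real or both complex. A basis is an infinite sequence; it is unconditional if every vector has a unique expansion with respect to it and this expansion converges unconditionally. For $0<p<\infty$, an unconditional basis is said to have an upper $p$-estimate (respectively, a lower $p$-estimate) if there is a constant $0<C<\infty$ such that, for every finite sequence $x_1,\dots,x_n$ of vectors that are disjointly supported with respect to the basis, $$\Big\|\sum_{k=1}^n x_k\Big\|^p\le C^p\sum_{k=1}^n\|x_k\|^p\qquad\Big(\text{respectively, } \Big\|\sum_{k=1}^n x_k\Big\|^p\ge C^p\sum_{k=1}^n\|x_k\|^p\Big).$$ Suppose that $X$ has an unconditional basis with an upper $p$-estimate for some $0<p<\infty$, and that there is a bijection $U:X\to Y$ such that $U$ and $U^{-1}$ are both uniformly continuous. Then for every closed linear subspace $M$ of $Y$ and every $0<r<p$, the quotient space $Y/M$ has no unconditional basis with a lower $r$-estimate. -/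

import Mathlib

namespace UnconditionalSchauderBasis

variable {𝕜 X : Type*} [RCLike 𝕜] [NormedAddCommGroup X] [NormedSpace 𝕜 X]

/-- A finite sequence of vectors is disjointly supported with respect to the unconditional
basis `b`: no basis vector has a nonzero coefficient in two of its members. -/
def DisjointlySupported (b : UnconditionalSchauderBasis ℕ 𝕜 X) {n : ℕ} (x : Fin n → X) : Prop :=
  ∀ j k : Fin n, j ≠ k → Disjoint {i : ℕ | b.coord i (x j) ≠ 0} {i : ℕ | b.coord i (x k) ≠ 0}

/-- The unconditional basis `b` has an upper `p`-estimate. -/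
def HasUpperEstimate (b : UnconditionalSchauderBasis ℕ 𝕜 X) (p : ℝ) : Prop :=
  ∃ C : ℝ, 0 < C ∧ ∀ (n : ℕ) (x : Fin n → X), DisjointlySupported b x →
    ‖∑ k, x k‖ ^ p ≤ C ^ p * ∑ k, ‖x k‖ ^ p

/-- The unconditional basis `b` has a lower `p`-estimate. -/
def HasLowerEstimate (b : UnconditionalSchauderBasis ℕ 𝕜 X) (p : ℝ) : Prop :=
  ∃ C : ℝ, 0 < C ∧ ∀ (n : ℕ) (x : Fin n → X), DisjointlySupported b x →
    C ^ p * ∑ k, ‖x k‖ ^ p ≤ ‖∑ k, x k‖ ^ p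

end UnconditionalSchauderBasis

/-
Let `F : X → Y / M` be the uniform homeomorphism followed by the quotient map. At large distances it
is Lipschitz, also if a displacement is measured by the `ℓ^p`-sum of its disjoint pieces and the
increment of `F` by the `ℓ^r`-sum of its disjoint blocks. Take `x`, `x'` on which the constant `L`
of this estimate is almost attained at scale `τ`, and let `m` be their midpoint. For `v` of norm at
most `σ τ` supported far out, the estimate between `m + v` and `x`, `x'` loses only a factor
`(1 + σ ^ p) ^ (1 / p)`. Since `r < p`, this forces the far coordinates of `F (m + v)` to be within
`c σ L τ` of those of `F x` or `F x'`, where `c` is as small as we like if `σ` is small. On the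
other hand, by the Gorelik principle, `F` maps the ball of tail vectors of radius `σ τ` around `m`
onto a set which contains, modulo a compact set, a ball of radius proportional to `σ τ`, so some far
coordinate must be large.
-/

section BoundedPerturbation

open MeasureTheory Metric Set Topology Module
open scoped NNReal Polynomial

theorem lipschitzWith_indicator_closedBall {E F : Type*} [NormedAddCommGroup E] [NormedSpace ℝ E]
    [NormedAddCommGroup F] {g : E → F} {ρ : ℝ} {L : ℝ≥0} (hg : LipschitzOnWith L g (closedBall 0 ρ))
    (h0 : ∀ x, ‖x‖ = ρ → g x = 0) : LipschitzWith L ((closedBall (0 : E) ρ).indicator g) := by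
  have dist_le_of_notMem : ∀ x ∈ closedBall (0 : E) ρ, ∀ y ∉ closedBall (0 : E) ρ,
      dist (g x) 0 ≤ L * dist x y := by
    intro x hx y hy
    rw [mem_closedBall_zero_iff] at hx hy
    obtain ⟨t, ht, hty⟩ : ∃ t ∈ Icc (0 : ℝ) 1, ‖AffineMap.lineMap x y t‖ = ρ :=
      intermediate_value_Icc zero_le_one
        (continuous_norm.comp AffineMap.lineMap_continuous).continuousOn
        (by simpa using ⟨hx, (not_le.1 hy).le⟩)
    calc dist (g x) 0 = dist (g x) (g (AffineMap.lineMap x y t)) := by rw [h0 _ hty]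
      _ ≤ L * dist x (AffineMap.lineMap x y t) :=
          hg.dist_le_mul x (by simpa using hx) _ (by simp [hty])
      _ ≤ L * dist x y := by
          rw [dist_left_lineMap, Real.norm_of_nonneg ht.1]
          gcongr
          exact mul_le_of_le_one_left dist_nonneg ht.2
  refine LipschitzWith.of_dist_le_mul fun x y => ?_
  by_cases hx : x ∈ closedBall (0 : E) ρ <;> by_cases hy : y ∈ closedBall (0 : E) ρ
  · simpa [indicator_of_mem hx, indicator_of_mem hy] using hg.dist_le_mul x hx y hy
  · simpa [indicator_of_mem hx, indicator_of_notMem hy] using dist_le_of_notMem x hx y hy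
  · simpa [indicator_of_notMem hx, indicator_of_mem hy, dist_comm] using dist_le_of_notMem y hy x hx
  · simpa [indicator_of_notMem hx, indicator_of_notMem hy] using by positivity

theorem bijective_id_add_of_lipschitzWith {E : Type*} [NormedAddCommGroup E] [NormedSpace ℝ E]
    [CompleteSpace E] {g : E → E} {c : ℝ≥0} (hg : LipschitzWith c g) (hc : c < 1) :
    Function.Bijective fun x => x + g x := by
  have happrox : ApproximatesLinearOn (fun x => x + g x)
      (ContinuousLinearEquiv.refl ℝ E : E →L[ℝ] E) univ c := by
    rw [ApproximatesLinearOn.approximatesLinearOn_iff_lipschitzOnWith, lipschitzOnWith_univ]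
    convert hg using 1
    ext x
    simp
  have hlt : Subsingleton E ∨ c < ‖((ContinuousLinearEquiv.refl ℝ E).symm : E →L[ℝ] E)‖₊⁻¹ := by
    rcases subsingleton_or_nontrivial E with hE | hE
    · exact Or.inl hE
    · exact Or.inr (by simpa using hc)
  exact ⟨injOn_univ.1 (happrox.injOn hlt), happrox.surjective hlt⟩

theorem bijOn_ball_id_add_of_lipschitzOnWith {E : Type*} [NormedAddCommGroup E] [NormedSpace ℝ E]
    [CompleteSpace E] {g : E → E} {ρ : ℝ} {c : ℝ≥0} (hg : LipschitzOnWith c g (closedBall 0 ρ))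
    (hc : c < 1) (h0 : ∀ x, ‖x‖ = ρ → g x = 0) :
    BijOn (fun x => x + g x) (ball 0 ρ) (ball 0 ρ) := by
  set G := (closedBall (0 : E) ρ).indicator g
  have hbij : Function.Bijective fun x => x + G x :=
    bijective_id_add_of_lipschitzWith (lipschitzWith_indicator_closedBall hg h0) hc
  have hG : ∀ x ∉ ball (0 : E) ρ, G x = 0 := by
    intro x hx
    rw [mem_ball_zero_iff, not_lt] at hx
    rcases hx.eq_or_lt with h | h
    · exact indicator_apply_eq_zero.2 fun _ => h0 x h.symm
    · exact indicator_of_notMem (by simpa using h) g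
  have himage : (fun x => x + G x) '' ball 0 ρ = ball 0 ρ := by
    refine compl_injective ?_
    rw [← image_compl_eq hbij]
    exact (image_congr fun x hx => by simp [hG x hx]).trans (image_id' _)
  refine BijOn.congr ⟨?_, hbij.injective.injOn, himage.ge⟩ fun x hx => ?_
  · exact mapsTo_iff_image_subset.2 himage.le
  · simp [G, indicator_of_mem (ball_subset_closedBall hx)]

variable {E : Type*} [NormedAddCommGroup E] [NormedSpace ℝ E] [FiniteDimensional ℝ E]

theorem det_one_add_pos_of_norm_lt_one {A : E →L[ℝ] E} (hA : ‖A‖ < 1) : 0 < (1 + A).det := by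
  have : CompleteSpace E := FiniteDimensional.complete ℝ E
  have hne : ∀ t ∈ Icc (0 : ℝ) 1, (1 + t • A).det ≠ 0 := by
    intro t ht
    have hlt : ‖-(t • A)‖ < 1 := by
      rw [norm_neg, norm_smul, Real.norm_of_nonneg ht.1]
      exact (mul_le_of_le_one_left (norm_nonneg A) ht.2).trans_lt hA
    have hunit := isUnit_one_sub_of_norm_lt_one hlt
    rw [sub_neg_eq_add] at hunit
    have hmap : IsUnit ((1 + t • A : E →L[ℝ] E) : E →ₗ[ℝ] E) :=
      hunit.map ContinuousLinearMap.toLinearMapRingHom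
    exact (hmap.map LinearMap.det).ne_zero
  have hcont : Continuous fun t : ℝ => (1 + t • A).det :=
    ContinuousLinearMap.continuous_det.comp (by fun_prop)
  have hzero : (1 + (0 : ℝ) • A).det = 1 := by
    rw [zero_smul, add_zero]
    exact LinearMap.det_id
  by_contra! hle
  obtain ⟨t, ht, ht0⟩ := intermediate_value_Icc' zero_le_one hcont.continuousOn
    (show (0 : ℝ) ∈ Icc _ _ by rw [one_smul, hzero]; exact ⟨hle, zero_le_one⟩)
  exact hne t ht ht0

theorem exists_polynomial_eval_eq_det_one_add_smul (A : E →L[ℝ] E) :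
    ∃ P : ℝ[X], P.degree < finrank ℝ E + 1 ∧ ∀ t, P.eval t = (1 + t • A).det := by
  let B := LinearMap.toMatrix (finBasis ℝ E) (finBasis ℝ E) (A : E →ₗ[ℝ] E)
  refine ⟨Matrix.det ((Polynomial.X : ℝ[X]) • B.map Polynomial.C +
    (1 : Matrix _ _ ℝ).map Polynomial.C), ?_, fun t => ?_⟩
  · refine Polynomial.degree_le_natDegree.trans_lt ?_
    have hle := Polynomial.natDegree_det_X_add_C_le B 1
    rw [Fintype.card_fin] at hle
    exact_mod_cast Nat.lt_succ_of_le hle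
  · have hdet : (1 + t • A).det = LinearMap.det ((1 : E →ₗ[ℝ] E) + t • (A : E →ₗ[ℝ] E)) := rfl
    rw [hdet, ← LinearMap.det_toMatrix (finBasis ℝ E), _root_.eval_det]
    congr 1
    ext i j
    by_cases hij : i = j <;> simp [B, hij, add_comm, mul_comm, LinearMap.toMatrix_one]

theorem exists_interpolation_eval_one (n : ℕ) {τ : ℝ} (hτ : 0 < τ) :
    ∃ v w : Fin n → ℝ, (∀ i, v i ∈ Ioo 0 τ) ∧
      ∀ P : ℝ[X], P.degree < n → P.eval 1 = ∑ i, w i * P.eval (v i) := by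
  let v : Fin n → ℝ := fun i => τ / ((i : ℝ) + 2)
  have hv : InjOn v (Finset.univ : Finset (Fin n)) := by
    intro i _ j _ hij
    rw [div_eq_div_iff (by positivity) (by positivity)] at hij
    have hji : (j : ℝ) = i := add_right_cancel (mul_left_cancel₀ hτ.ne' hij)
    exact Fin.ext (by exact_mod_cast hji.symm)
  refine ⟨v, fun i => (Lagrange.basis Finset.univ v i).eval 1, fun i => ⟨by positivity, ?_⟩,
    fun P hP => ?_⟩
  · exact div_lt_self hτ (by have : (0 : ℝ) ≤ i := by positivity
                             linarith)
  · conv_lhs => rw [Lagrange.eq_interpolate (f := P) hv (by simpa using hP)]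
    simp only [Lagrange.interpolate_apply, Polynomial.eval_finsetSum, Polynomial.eval_mul,
      Polynomial.eval_C, mul_comm]

variable [MeasurableSpace E] [BorelSpace E] (μ : Measure E) [μ.IsAddHaarMeasure]

theorem setIntegral_ball_det_one_add_fderiv_of_lipschitzOnWith {g : E → E} {ρ : ℝ} {c : ℝ≥0}
    (hg : LipschitzOnWith c g (closedBall 0 ρ)) (hc : c < 1) (h0 : ∀ x, ‖x‖ = ρ → g x = 0)
    (hd : Differentiable ℝ g) :
    ∫ x in ball 0 ρ, (1 + fderiv ℝ g x).det ∂μ = μ.real (ball 0 ρ) := by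
  have : CompleteSpace E := FiniteDimensional.complete ℝ E
  have hbij := bijOn_ball_id_add_of_lipschitzOnWith hg hc h0
  have hderiv : ∀ x ∈ ball (0 : E) ρ,
      HasFDerivWithinAt (fun x => x + g x) (1 + fderiv ℝ g x) (ball 0 ρ) x := fun x _ =>
    ((hasFDerivAt_id x).add (hd x).hasFDerivAt).hasFDerivWithinAt
  have hpos : ∀ x ∈ ball (0 : E) ρ, 0 < (1 + fderiv ℝ g x).det := fun x hx =>
    det_one_add_pos_of_norm_lt_one <|
      (norm_fderiv_le_of_lipschitzOn ℝ (closedBall_mem_nhds_of_mem hx) hg).trans_lt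
        (by exact_mod_cast hc)
  have hchange := integral_image_eq_integral_abs_det_fderiv_smul μ measurableSet_ball hderiv
    hbij.injOn fun _ => (1 : ℝ)
  rw [hbij.image_eq] at hchange
  simp only [smul_eq_mul, mul_one, integral_const, measureReal_restrict_apply_univ] at hchange
  rw [hchange]
  exact setIntegral_congr_fun measurableSet_ball fun x hx => (abs_of_pos (hpos x hx)).symm

/- For small `t > 0` the map `x ↦ x + t • g x` is a diffeomorphism of the ball onto itself, so the
integral of its Jacobian is the volume of the ball. This integral is a polynomial in `t`, so it
does not change up to `t = 1` (Milnor, Rogers). -/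
theorem setIntegral_ball_det_one_add_fderiv {g : E → E} (hg : ContDiff ℝ 1 g) {ρ : ℝ}
    (h0 : ∀ x, ‖x‖ = ρ → g x = 0) :
    ∫ x in ball 0 ρ, (1 + fderiv ℝ g x).det ∂μ = μ.real (ball 0 ρ) := by
  obtain ⟨L, hL⟩ := hg.contDiffOn.exists_lipschitzOnWith one_ne_zero (convex_closedBall 0 ρ)
    (isCompact_closedBall 0 ρ)
  have hsmall : ∀ t ∈ Ioo (0 : ℝ) (1 / (L + 1)),
      ∫ x in ball 0 ρ, (1 + t • fderiv ℝ g x).det ∂μ = μ.real (ball 0 ρ) := by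
    intro t ht
    have hfderiv : ∀ x, fderiv ℝ (t • g) x = t • fderiv ℝ g x := fun x =>
      fderiv_const_smul (hg.differentiable one_ne_zero x) t
    simp only [← hfderiv]
    refine setIntegral_ball_det_one_add_fderiv_of_lipschitzOnWith μ (c := ‖t‖₊ * L)
      ((lipschitzWith_smul t).comp_lipschitzOnWith hL) ?_ (fun x hx => by simp [h0 x hx])
      ((hg.differentiable one_ne_zero).const_smul t)
    rw [← NNReal.coe_lt_coe]
    push_cast
    rw [Real.norm_of_nonneg ht.1.le]
    have := (lt_div_iff₀ (by positivity)).1 ht.2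
    linarith [ht.1]
  obtain ⟨v, w, hv, hvw⟩ := exists_interpolation_eval_one (finrank ℝ E + 1)
    (show 0 < 1 / ((L : ℝ) + 1) by positivity)
  have hdet : ∀ A : E →L[ℝ] E, (1 + A).det = ∑ i, w i * (1 + v i • A).det := by
    intro A
    obtain ⟨P, hdeg, hP⟩ := exists_polynomial_eval_eq_det_one_add_smul A
    simpa [hP] using hvw P (by exact_mod_cast hdeg)
  have hw : ∑ i, w i = 1 := by
    have hdeg : (1 : ℝ[X]).degree < (finrank ℝ E + 1 : ℕ) := by
      rw [Polynomial.degree_one]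
      exact_mod_cast Nat.succ_pos _
    simpa using (hvw 1 hdeg).symm
  have hInt : ∀ i, IntegrableOn (fun x => w i * (1 + v i • fderiv ℝ g x).det) (ball 0 ρ) μ := by
    intro i
    have hfderiv : Continuous fun x => v i • fderiv ℝ g x :=
      (hg.continuous_fderiv one_ne_zero).const_smul (v i)
    have hcont : Continuous fun x => w i * (1 + v i • fderiv ℝ g x).det :=
      continuous_const.mul <| ContinuousLinearMap.continuous_det.comp <|
        continuous_const.add hfderiv
    exact (hcont.continuousOn.integrableOn_compact (isCompact_closedBall _ _)).mono_set
      ball_subset_closedBall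
  calc ∫ x in ball 0 ρ, (1 + fderiv ℝ g x).det ∂μ
      = ∑ i, w i * ∫ x in ball 0 ρ, (1 + v i • fderiv ℝ g x).det ∂μ := by
        simp only [hdet (fderiv ℝ g _), integral_finsetSum _ fun i _ => hInt i, integral_const_mul]
    _ = ∑ i, w i * μ.real (ball 0 ρ) := by simp only [hsmall _ (hv _)]
    _ = μ.real (ball 0 ρ) := by rw [← Finset.sum_mul, hw, one_mul]

end BoundedPerturbation

section Zeros

open MeasureTheory Metric Set Topology Module

section InnerProduct

variable {E : Type*} [NormedAddCommGroup E] [InnerProductSpace ℝ E] [FiniteDimensional ℝ E]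

theorem det_fderiv_eq_zero_of_norm_eq {f : E → E} (hf : Differentiable ℝ f) {ρ : ℝ} (hρ : ρ ≠ 0)
    (hfρ : ∀ x, ‖f x‖ = ρ) (x : E) : (fderiv ℝ f x).det = 0 := by
  by_contra hne
  have horth : ∀ w, inner ℝ (f x) (fderiv ℝ f x w) = 0 := by
    intro w
    have hconst : HasFDerivAt (fun y => ‖f y‖ ^ 2) (0 : E →L[ℝ] ℝ) x := by
      simpa only [hfρ] using hasFDerivAt_const (ρ ^ 2) x
    simpa using congrArg (fun T : E →L[ℝ] ℝ => T w) ((hf x).hasFDerivAt.norm_sq.unique hconst)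
  obtain ⟨w, hw⟩ := ((fderiv ℝ f x).toContinuousLinearEquivOfDetNeZero hne).surjective (f x)
  rw [ContinuousLinearMap.toContinuousLinearEquivOfDetNeZero_apply] at hw
  have hfx : f x = 0 := inner_self_eq_zero.1 (hw ▸ horth w)
  exact hρ (by rw [← hfρ x, hfx, norm_zero])

theorem not_exists_contDiff_retraction_sphere {ρ : ℝ} (hρ : 0 < ρ) :
    ¬ ∃ f : E → E, ContDiff ℝ 1 f ∧ (∀ x, ‖f x‖ = ρ) ∧ ∀ x, ‖x‖ = ρ → f x = x := by
  rintro ⟨f, hf, hfρ, hid⟩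
  borelize E
  have hd : Differentiable ℝ f := hf.differentiable one_ne_zero
  have hvol := setIntegral_ball_det_one_add_fderiv (ρ := ρ) (Measure.addHaar (G := E))
    (hf.sub contDiff_id) fun x (hx : ‖x‖ = ρ) => by simp [hid x hx]
  have hfderiv : ∀ x, 1 + fderiv ℝ (fun y => f y - id y) x = fderiv ℝ f x := by
    intro x
    rw [fderiv_fun_sub (hd x) differentiableAt_id, fderiv_id]
    exact add_sub_cancel _ _
  simp only [hfderiv, det_fderiv_eq_zero_of_norm_eq hd hρ.ne' hfρ, integral_zero] at hvol
  have hpos : 0 < Measure.addHaar.real (ball (0 : E) ρ) :=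
    ENNReal.toReal_pos (measure_ball_pos _ 0 hρ).ne' measure_ball_lt_top.ne
  exact hpos.ne hvol

theorem exists_eq_zero_of_eq_self_of_le_norm {φ : E → E} (hφ : Continuous φ) {R : ℝ} (hR : 0 < R)
    (hid : ∀ x, R ≤ ‖x‖ → φ x = x) : ∃ x, φ x = 0 := by
  by_contra! hne
  set V : Set E := (closedBall 0 R)ᶜ
  have hVS : V ∈ 𝓝ˢ (ball (0 : E) (R + 1))ᶜ :=
    isClosed_closedBall.isOpen_compl.mem_nhdsSet.2 <| compl_subset_compl.2 <|
      closedBall_subset_ball (lt_add_one R)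
  have hsmooth : ContDiffOn ℝ ((1 : ℕ∞) : WithTop ℕ∞) φ V :=
    contDiffOn_id.congr fun x hx => hid x (by simpa [V] using hx : R < ‖x‖).le
  obtain ⟨ψ, hψ, hψφ, hψS, -⟩ := hφ.exists_contDiff_approx_and_eqOn 1 hφ.norm
    (fun x => norm_pos_iff.2 (hne x)) isOpen_ball.isClosed_compl hVS hsmooth
  have hψ1 : ContDiff ℝ 1 ψ := by exact_mod_cast hψ
  have hψne : ∀ x, ψ x ≠ 0 := fun x hx => by simpa [hx] using hψφ x
  refine not_exists_contDiff_retraction_sphere (E := E) (show 0 < R + 1 by linarith)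
    ⟨fun x => ((R + 1) / ‖ψ x‖) • ψ x, ?_, fun x => ?_, fun x hx => ?_⟩
  · exact (contDiff_const.div (hψ1.norm ℝ hψne) fun x => norm_ne_zero_iff.2 (hψne x)).smul hψ1
  · rw [norm_smul, Real.norm_of_nonneg (by positivity),
      div_mul_cancel₀ _ (norm_ne_zero_iff.2 (hψne x))]
  · have hψx : ψ x = x := by rw [hψS (by simp [hx]), hid x (by linarith)]
    simp only [hψx, hx, div_self (by linarith : R + 1 ≠ 0), one_smul]

theorem exists_eq_zero_of_norm_sub_le_of_inner {φ : E → E} (hφ : Continuous φ) {R : ℝ}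
    (hR : ∀ x, ‖φ x - x‖ ≤ R) : ∃ x, φ x = 0 := by
  have hR0 : 0 ≤ R := (norm_nonneg _).trans (hR 0)
  let χ : E → ℝ := fun x => max 0 (min 1 (R + 2 - ‖x‖))
  obtain ⟨x, hx⟩ := exists_eq_zero_of_eq_self_of_le_norm (φ := fun x => x + χ x • (φ x - x))
    (by fun_prop) (show 0 < R + 2 by linarith) fun x hx => by
      simp [χ, min_le_of_right_le (show R + 2 - ‖x‖ ≤ 0 by linarith)]
  have hxR : ‖x‖ ≤ R := by
    calc ‖x‖ = |χ x| * ‖φ x - x‖ := by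
          rw [eq_neg_of_add_eq_zero_left hx, norm_neg, norm_smul, ← eq_neg_of_add_eq_zero_left hx,
            Real.norm_eq_abs]
      _ ≤ 1 * R := by
          gcongr
          · rw [abs_of_nonneg (le_max_left _ _)]
            exact max_le zero_le_one (min_le_left _ _)
          · exact hR x
      _ = R := one_mul R
  have hχ : χ x = 1 := by simp [χ, min_eq_left (show 1 ≤ R + 2 - ‖x‖ by linarith)]
  exact ⟨x, by simpa [hχ] using hx⟩

end InnerProduct

theorem exists_eq_zero_of_norm_sub_le (𝕜 : Type*) [RCLike 𝕜] {V : Type*} [NormedAddCommGroup V]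
    [NormedSpace 𝕜 V] [FiniteDimensional 𝕜 V] {φ : V → V} (hφ : Continuous φ) {R : ℝ}
    (hR : ∀ x, ‖φ x - x‖ ≤ R) : ∃ x, φ x = 0 := by
  let _ : NormedSpace ℝ V := NormedSpace.restrictScalars ℝ 𝕜 V
  have : IsScalarTower ℝ 𝕜 V := RestrictScalars.isScalarTower ℝ 𝕜 V
  have : FiniteDimensional ℝ V := FiniteDimensional.trans ℝ 𝕜 V
  let e : V ≃L[ℝ] EuclideanSpace ℝ (Fin (finrank ℝ V)) := toEuclidean
  obtain ⟨x, hx⟩ := exists_eq_zero_of_norm_sub_le_of_inner (φ := fun x => e (φ (e.symm x)))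
    (by fun_prop) fun x => calc
      ‖e (φ (e.symm x)) - x‖ = ‖e (φ (e.symm x) - e.symm x)‖ := by simp
      _ ≤ ‖(e : V →L[ℝ] EuclideanSpace ℝ (Fin (finrank ℝ V)))‖ * ‖φ (e.symm x) - e.symm x‖ :=
          (e : V →L[ℝ] EuclideanSpace ℝ (Fin (finrank ℝ V))).le_opNorm _
      _ ≤ ‖(e : V →L[ℝ] EuclideanSpace ℝ (Fin (finrank ℝ V)))‖ * R := by gcongr; exact hR _
  exact ⟨e.symm x, by simpa using hx⟩

end Zeros

section CoarseLipschitz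

variable {α β : Type*} [PseudoMetricSpace α] [PseudoMetricSpace β]

/-- A map is coarse Lipschitz if it is Lipschitz at large distances, here at distances at least `1`,
and separates points at smaller distances by a bounded amount. -/
def IsCoarseLipschitz (f : α → β) : Prop :=
  ∃ Λ > 0, ∀ x y, dist (f x) (f y) ≤ Λ * max 1 (dist x y)

theorem isCoarseLipschitz_of_uniformContinuous (𝕜 : Type*) [RCLike 𝕜] {E : Type*}
    [SeminormedAddCommGroup E] [NormedSpace 𝕜 E] {f : E → β} (hf : UniformContinuous f) :
    IsCoarseLipschitz f := by
  let _ : NormedSpace ℝ E := NormedSpace.restrictScalars ℝ 𝕜 E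
  obtain ⟨δ, hδ, hfδ⟩ := Metric.uniformContinuous_iff.1 hf 1 one_pos
  refine ⟨1 / δ + 1, by positivity, fun x y => ?_⟩
  set n := ⌊dist x y / δ⌋₊ + 1 with hn
  have hn0 : (0 : ℝ) < n := by positivity
  have hn_gt : dist x y / δ < n := by simpa [hn] using Nat.lt_floor_add_one (dist x y / δ)
  have hn_le : (n : ℝ) ≤ dist x y / δ + 1 := by
    simpa [hn] using Nat.floor_le (show 0 ≤ dist x y / δ by positivity)
  let w : ℕ → E := fun k => AffineMap.lineMap x y ((k : ℝ) / n)
  have hstep : ∀ k, dist (f (w k)) (f (w (k + 1))) ≤ 1 := by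
    intro k
    refine (hfδ ?_).le
    calc dist (w k) (w (k + 1)) = dist x y / n := by
          rw [dist_lineMap_lineMap, Real.dist_eq, ← sub_div, Nat.cast_succ, sub_add_cancel_left,
            abs_div, abs_neg, abs_one, Nat.abs_cast, one_div_mul_eq_div]
      _ < δ := (div_lt_comm₀ hδ hn0).1 hn_gt
  calc dist (f x) (f y) = dist (f (w 0)) (f (w n)) := by simp [w, hn0.ne']
    _ ≤ ∑ _k ∈ Finset.range n, (1 : ℝ) :=
        dist_le_range_sum_of_dist_le n fun {k} _ => hstep k
    _ ≤ dist x y / δ + 1 := by simpa using hn_le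
    _ ≤ max 1 (dist x y) / δ + max 1 (dist x y) := by
        gcongr
        exacts [le_max_right _ _, le_max_left _ _]
    _ = (1 / δ + 1) * max 1 (dist x y) := by ring

theorem IsCoarseLipschitz.lipschitzWith_comp {γ : Type*} [PseudoMetricSpace γ] {g : β → γ}
    {f : α → β} {Λ : NNReal} (hg : LipschitzWith Λ g) (hf : IsCoarseLipschitz f) :
    IsCoarseLipschitz (g ∘ f) := by
  obtain ⟨Λ', hΛ', hf⟩ := hf
  refine ⟨(Λ + 1) * Λ', by positivity, fun x y => ?_⟩
  calc dist (g (f x)) (g (f y)) ≤ Λ * dist (f x) (f y) := hg.dist_le_mul _ _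
    _ ≤ (Λ + 1) * (Λ' * max 1 (dist x y)) := by
        gcongr
        exacts [(lt_add_one _).le, hf x y]
    _ = (Λ + 1) * Λ' * max 1 (dist x y) := by ring

end CoarseLipschitz

section LpSum

variable {ι E : Type*} [Fintype ι] [SeminormedAddCommGroup E] {p : ℝ}

/-- The `ℓ^p`-sum `(∑ k, ‖u k‖ ^ p) ^ (1 / p)` of the norms of a finite family of vectors, for a
positive real exponent `p`. -/
noncomputable def lpSum (p : ℝ) (u : ι → E) : ℝ :=
  (∑ k, ‖u k‖ ^ p) ^ (1 / p)

theorem lpSum_nonneg (p : ℝ) (u : ι → E) : 0 ≤ lpSum p u := by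
  unfold lpSum
  positivity

theorem lpSum_rpow (hp : p ≠ 0) (u : ι → E) : lpSum p u ^ p = ∑ k, ‖u k‖ ^ p := by
  rw [lpSum, one_div, Real.rpow_inv_rpow (by positivity) hp]

theorem lpSum_of_unique [Unique ι] (hp : p ≠ 0) (u : ι → E) : lpSum p u = ‖u default‖ := by
  rw [lpSum, Fintype.sum_unique, one_div, Real.rpow_rpow_inv (norm_nonneg _) hp]

theorem lpSum_cons_rpow (hp : p ≠ 0) {n : ℕ} (v : E) (u : Fin n → E) :
    lpSum p (Fin.cons v u : Fin (n + 1) → E) ^ p = ‖v‖ ^ p + lpSum p u ^ p := by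
  simp only [lpSum_rpow hp, Fin.sum_univ_succ, Fin.cons_zero, Fin.cons_succ]

theorem lpSum_le_lpSum_cons (hp : 0 < p) {n : ℕ} (v : E) (u : Fin n → E) :
    lpSum p u ≤ lpSum p (Fin.cons v u : Fin (n + 1) → E) := by
  rw [← Real.rpow_le_rpow_iff (lpSum_nonneg p u) (lpSum_nonneg p _) hp, lpSum_cons_rpow hp.ne']
  exact le_add_of_nonneg_left (by positivity)

theorem lpSum_cons_le (hp : 0 < p) {n : ℕ} {v : E} {u : Fin n → E} {σ : ℝ} (hσ : 0 ≤ σ)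
    (hv : ‖v‖ ≤ σ * lpSum p u) :
    lpSum p (Fin.cons v u : Fin (n + 1) → E) ≤ (1 + σ ^ p) ^ (1 / p) * lpSum p u := by
  have hu : 0 ≤ lpSum p u := lpSum_nonneg p u
  rw [← Real.rpow_le_rpow_iff (lpSum_nonneg p _) (by positivity) hp, lpSum_cons_rpow hp.ne']
  calc ‖v‖ ^ p + lpSum p u ^ p ≤ (σ * lpSum p u) ^ p + lpSum p u ^ p := by gcongr
    _ = ((1 + σ ^ p) ^ (1 / p) * lpSum p u) ^ p := by
        rw [Real.mul_rpow hσ hu, Real.mul_rpow (by positivity) hu, one_div,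
          Real.rpow_inv_rpow (by positivity) hp.ne', add_mul, one_mul, add_comm]

theorem lpSum_smul {𝕜 : Type*} [NormedField 𝕜] [NormedSpace 𝕜 E] (hp : p ≠ 0) (c : 𝕜)
    (u : ι → E) : lpSum p (fun k => c • u k) = ‖c‖ * lpSum p u := by
  simp only [lpSum, norm_smul, Real.mul_rpow (norm_nonneg c) (norm_nonneg _), ← Finset.mul_sum]
  rw [Real.mul_rpow (by positivity) (by positivity), one_div,
    Real.rpow_rpow_inv (norm_nonneg c) hp]

theorem lpSum_add_le (hp : 1 ≤ p) (u v : ι → E) :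
    lpSum p (fun k => u k + v k) ≤ lpSum p u + lpSum p v := by
  have hmink := Real.Lp_add_le Finset.univ (fun k => ‖u k‖) (fun k => ‖v k‖) hp
  simp only [abs_norm] at hmink
  refine le_trans ?_ hmink
  unfold lpSum
  gcongr with k
  exact (norm_add_le _ _).trans (le_abs_self _)

theorem continuous_lpSum (hp : 0 < p) : Continuous (lpSum p : (ι → E) → ℝ) := by
  have hcoord : ∀ k : ι, Continuous fun u : ι → E => ‖u k‖ ^ p := fun k =>
    (continuous_apply k).norm.rpow_const fun _ => Or.inr hp.le
  exact (continuous_finsetSum _ fun k _ => hcoord k).rpow_const fun _ => Or.inr (by positivity)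

end LpSum

section Scalars

theorem exists_pos_mul_and_not_of_forall_le {P : ℝ → Prop} {c L' θ : ℝ} (hc : 0 < c)
    (hP : ∀ L > 0, P L → c ≤ L) (hθ : 1 < θ) (hL' : 0 < L') (hPL' : P L') :
    ∃ L, 0 < L ∧ L ≤ L' ∧ P (θ * L) ∧ ¬ P L := by
  have : 0 < θ := one_pos.trans hθ
  have hex : ∃ n : ℕ, ¬ P (L' / θ ^ n) := by
    obtain ⟨n, hn⟩ := pow_unbounded_of_one_lt (L' / c) hθ
    refine ⟨n, fun hPn => (hP _ (by positivity) hPn).not_gt ?_⟩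
    rwa [div_lt_comm₀ (by positivity) hc]
  classical
  obtain ⟨n, hn⟩ : ∃ n, Nat.find hex = n + 1 :=
    Nat.exists_eq_succ_of_ne_zero fun h0 => by simpa [h0, hPL'] using Nat.find_spec hex
  refine ⟨L' / θ ^ (n + 1), by positivity, div_le_self hL'.le (one_le_pow₀ hθ.le), ?_,
    hn ▸ Nat.find_spec hex⟩
  have hPn : P (L' / θ ^ n) := not_not.1 (Nat.find_min hex (hn ▸ n.lt_succ_self))
  convert hPn using 1
  rw [pow_succ]
  field_simp

theorem exists_rpow_le_one_add_rpow {p r c : ℝ} (hr : 0 < r) (hrp : r < p) (hc : 0 < c) :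
    ∃ σ > 0, ∃ θ > 1, (θ * (1 + σ ^ p) ^ (1 / p)) ^ r ≤ 1 + (c * σ) ^ r := by
  have hp : 0 < p := hr.trans hrp
  have hpr : p - r ≠ 0 := (sub_pos.2 hrp).ne'
  obtain ⟨σ, hσ, hσpr⟩ : ∃ σ > 0, σ ^ (p - r) = c ^ r / 2 :=
    ⟨_, by positivity, Real.rpow_inv_rpow (by positivity) hpr⟩
  have hσp : σ ^ p < (c * σ) ^ r := by
    rw [Real.mul_rpow hc.le hσ.le, ← sub_add_cancel p r, Real.rpow_add hσ, hσpr]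
    gcongr
    exact half_lt_self (by positivity)
  refine ⟨σ, hσ, ((1 + (c * σ) ^ r) / (1 + σ ^ p)) ^ (1 / r), Real.one_lt_rpow ?_ (by positivity),
    ?_⟩
  · rw [one_lt_div (by positivity)]
    gcongr
  · calc (((1 + (c * σ) ^ r) / (1 + σ ^ p)) ^ (1 / r) * (1 + σ ^ p) ^ (1 / p)) ^ r
        = (1 + (c * σ) ^ r) / (1 + σ ^ p) * (1 + σ ^ p) ^ (r / p) := by
          rw [Real.mul_rpow (by positivity) (by positivity), one_div,
            Real.rpow_inv_rpow (by positivity) hr.ne', ← Real.rpow_mul (by positivity),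
            one_div_mul_eq_div]
      _ ≤ (1 + (c * σ) ^ r) / (1 + σ ^ p) * (1 + σ ^ p) := by
          gcongr
          exact Real.rpow_le_self_of_one_le (by linarith [Real.rpow_pos_of_pos hσ p])
            ((div_le_one hp).2 hrp.le)
      _ = 1 + (c * σ) ^ r := div_mul_cancel₀ _ (by positivity)

end Scalars

section UnconditionalBasis

open Filter Function Set Topology
open UnconditionalSchauderBasis (DisjointlySupported HasUpperEstimate HasLowerEstimate)

variable {𝕜 X : Type*} [RCLike 𝕜] [NormedAddCommGroup X] [NormedSpace 𝕜 X]

theorem basis_coord_proj (b : UnconditionalSchauderBasis ℕ 𝕜 X) (A : Finset ℕ) (x : X) (i : ℕ) :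
    b.coord i (b.proj A x) = if i ∈ A then b.coord i x else 0 := by
  simp [b.ortho, Pi.single_apply]

theorem coord_eq_zero_of_proj_range_eq_zero (b : UnconditionalSchauderBasis ℕ 𝕜 X) {N : ℕ} {x : X}
    (hx : b.proj (Finset.range N) x = 0) {i : ℕ} (hi : i < N) : b.coord i x = 0 := by
  rw [← map_zero (b.coord i), ← hx, basis_coord_proj, if_pos (Finset.mem_range.2 hi)]

theorem tendsto_proj_range (b : UnconditionalSchauderBasis ℕ 𝕜 X) (x : X) :
    Tendsto (fun N => b.proj (Finset.range N) x) atTop (𝓝 x) := by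
  have hproj := b.tendsto_proj x
  rw [SummationFilter.unconditional_filter] at hproj
  exact hproj.comp tendsto_finset_range

theorem tendsto_proj_singleton (b : UnconditionalSchauderBasis ℕ 𝕜 X) (x : X) :
    Tendsto (fun j => b.proj {j} x) atTop (𝓝 0) := by
  have hsub := ((tendsto_add_atTop_iff_nat 1).2 (tendsto_proj_range b x)).sub
    (tendsto_proj_range b x)
  rw [sub_self] at hsub
  exact hsub.congr fun j => by simp [Finset.sum_range_succ]

theorem exists_norm_smul_basis_eq (b : UnconditionalSchauderBasis ℕ 𝕜 X) (i : ℕ) {t : ℝ}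
    (ht : 0 ≤ t) : ∃ c : 𝕜, ‖c • b i‖ = t := by
  have hbi : ‖b i‖ ≠ 0 := norm_ne_zero_iff.2 (b.linearIndependent.ne_zero i)
  refine ⟨(t / ‖b i‖ : ℝ), ?_⟩
  rw [norm_smul, RCLike.norm_ofReal, abs_of_nonneg (by positivity), div_mul_cancel₀ _ hbi]

theorem tendstoUniformlyOn_zero_of_isCompact {E F : Type*} [NormedAddCommGroup E]
    [NormedSpace 𝕜 E] [NormedAddCommGroup F] [NormedSpace 𝕜 F] {T : ℕ → E →L[𝕜] F} {K : ℝ}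
    (hK : ∀ j, ‖T j‖ ≤ K) (hT : ∀ x, Tendsto (fun j => T j x) atTop (𝓝 0)) {S : Set E}
    (hS : IsCompact S) : TendstoUniformlyOn (fun j x => T j x) 0 atTop S := by
  rw [← tendstoLocallyUniformlyOn_iff_tendstoUniformlyOn_of_compact hS,
    Metric.tendstoLocallyUniformlyOn_iff]
  intro η hη x _
  have hK0 : 0 ≤ K := (norm_nonneg _).trans (hK 0)
  have hKη : 0 < η / (2 * (K + 1)) := by positivity
  refine ⟨_, mem_nhdsWithin_of_mem_nhds (Metric.ball_mem_nhds x hKη), ?_⟩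
  filter_upwards [(hT x).norm.eventually_lt_const
    (show ‖(0 : F)‖ < η / 2 by simpa using half_pos hη)] with j hj y hy
  rw [mem_ball_iff_norm, lt_div_iff₀ (by positivity)] at hy
  have hTy : ‖T j (y - x)‖ ≤ K * ‖y - x‖ := (T j).le_of_opNorm_le (hK j) _
  calc dist (0 : F) (T j y) = ‖T j (y - x) + T j x‖ := by
        rw [dist_zero_left, ← map_add, sub_add_cancel]
    _ ≤ ‖T j (y - x)‖ + ‖T j x‖ := norm_add_le _ _
    _ < η := by linarith [norm_nonneg (y - x)]

theorem disjointlySupported_of_forall_notMem {b : UnconditionalSchauderBasis ℕ 𝕜 X} {n : ℕ}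
    {u : Fin n → X} {A : Fin n → Set ℕ} (hA : Pairwise (Disjoint on A))
    (hu : ∀ k, ∀ i ∉ A k, b.coord i (u k) = 0) : DisjointlySupported b u :=
  fun j k hjk => (hA hjk).mono (fun i => not_imp_comm.1 (hu j i)) fun i => not_imp_comm.1 (hu k i)

theorem disjointlySupported_smul {b : UnconditionalSchauderBasis ℕ 𝕜 X} {n : ℕ} {u : Fin n → X}
    (hu : DisjointlySupported b u) (c : 𝕜) : DisjointlySupported b fun k => c • u k :=
  disjointlySupported_of_forall_notMem (fun j k hjk => hu j k hjk) fun k i hi => by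
    rw [map_smul, not_not.1 hi, smul_zero]

theorem disjointlySupported_proj {b : UnconditionalSchauderBasis ℕ 𝕜 X} {n : ℕ} {u : Fin n → X}
    (hu : DisjointlySupported b u) (A : Finset ℕ) :
    DisjointlySupported b fun k => b.proj A (u k) :=
  disjointlySupported_of_forall_notMem (fun j k hjk => hu j k hjk) fun k i hi => by
    rw [basis_coord_proj, not_not.1 hi, ite_self]

theorem disjointlySupported_blocks (b : UnconditionalSchauderBasis ℕ 𝕜 X) {m : ℕ}
    {A : Fin m → Finset ℕ} (hA : Pairwise (Disjoint on A)) (x : X) :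
    DisjointlySupported b fun k => b.proj (A k) x :=
  disjointlySupported_of_forall_notMem (A := fun k => A k)
    (fun j k hjk => Finset.disjoint_coe.2 (hA hjk)) fun k i hi => by
      rw [basis_coord_proj, if_neg (Finset.mem_coe.not.1 hi)]

theorem disjointlySupported_cons {b : UnconditionalSchauderBasis ℕ 𝕜 X} {n N : ℕ} {u : Fin n → X}
    {v : X} (hu : DisjointlySupported b u) (huN : ∀ k, ∀ i ≥ N, b.coord i (u k) = 0)
    (hv : ∀ i < N, b.coord i v = 0) : DisjointlySupported b (Fin.cons v u : Fin (n + 1) → X) := by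
  have hdisj : ∀ k, Disjoint {i | b.coord i v ≠ 0} {i | b.coord i (u k) ≠ 0} := fun k =>
    disjoint_left.2 fun i hiv hiu =>
      hiu (huN k i (not_lt.1 fun hiN => hiv (hv i hiN)))
  have hpair : Pairwise (Disjoint on fun k : Fin (n + 1) =>
      {i | b.coord i ((Fin.cons v u : Fin (n + 1) → X) k) ≠ 0}) :=
    pairwise_fin_succ_iff_of_isSymm.2 ⟨hdisj, fun j k hjk => hu j k hjk⟩
  exact fun j k hjk => hpair hjk

theorem exists_norm_sum_le_mul_lpSum {b : UnconditionalSchauderBasis ℕ 𝕜 X} {p : ℝ} (hp : 0 < p)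
    (hb : HasUpperEstimate b p) : ∃ C > 0, ∀ (n : ℕ) (u : Fin n → X), DisjointlySupported b u →
      ‖∑ k, u k‖ ≤ C * lpSum p u := by
  obtain ⟨C, hC, hb⟩ := hb
  refine ⟨C, hC, fun n u hu => ?_⟩
  rw [← Real.rpow_le_rpow_iff (norm_nonneg _) (mul_nonneg hC.le (lpSum_nonneg p u)) hp,
    Real.mul_rpow hC.le (lpSum_nonneg p u), lpSum_rpow hp.ne']
  exact hb n u hu

theorem exists_lpSum_proj_le_mul_norm [CompleteSpace X] {b : UnconditionalSchauderBasis ℕ 𝕜 X}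
    {r : ℝ} (hr : 0 < r) (hb : HasLowerEstimate b r) :
    ∃ D > 0, ∀ (m : ℕ) (A : Fin m → Finset ℕ), Pairwise (Disjoint on A) → ∀ x,
      lpSum r (fun k => b.proj (A k) x) ≤ D * ‖x‖ := by
  obtain ⟨C, hC, hb⟩ := hb
  obtain ⟨K, hK⟩ := b.exists_norm_proj_le
  have hK0 : 0 ≤ K := (norm_nonneg _).trans (hK ∅)
  refine ⟨(K + 1) / C, by positivity, fun m A hA x => ?_⟩
  set w : Fin m → X := fun k => b.proj (A k) x
  have hsum : ∑ k, w k = b.proj (Finset.univ.biUnion A) x := by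
    simp only [w, GeneralSchauderBasis.proj_apply]
    rw [Finset.sum_biUnion fun i _ j _ hij => hA hij]
  have hlower : C * lpSum r w ≤ ‖∑ k, w k‖ := by
    rw [← Real.rpow_le_rpow_iff (mul_nonneg hC.le (lpSum_nonneg r w)) (norm_nonneg _) hr,
      Real.mul_rpow hC.le (lpSum_nonneg r w), lpSum_rpow hr.ne']
    exact hb m w (disjointlySupported_blocks b hA x)
  rw [div_mul_eq_mul_div, le_div_iff₀' hC]
  calc C * lpSum r w ≤ ‖b.proj (Finset.univ.biUnion A) x‖ := hsum ▸ hlower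
    _ ≤ K * ‖x‖ := (b.proj _).le_of_opNorm_le (hK _) x
    _ ≤ (K + 1) * ‖x‖ := by gcongr; exact (lt_add_one K).le

theorem not_hasLowerEstimate_of_lt_one (b : UnconditionalSchauderBasis ℕ 𝕜 X) {r : ℝ}
    (hr : 0 < r) (hr1 : r < 1) : ¬ HasLowerEstimate b r := by
  rintro ⟨C, hC, hb⟩
  choose c hc using fun i => exists_norm_smul_basis_eq b i zero_le_one
  have hgrowth : ∀ n : ℕ, C ^ r * n ≤ (n : ℝ) ^ r := by
    intro n
    have hdisj : DisjointlySupported b fun k : Fin n => c k • b k :=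
      disjointlySupported_of_forall_notMem (A := fun k => {(k : ℕ)})
        (fun j k hjk => disjoint_singleton.2 (Fin.val_ne_of_ne hjk)) fun k i hi => by
          simp [b.ortho, mem_singleton_iff.not.1 hi]
    calc C ^ r * n = C ^ r * ∑ k : Fin n, ‖c k • b k‖ ^ r := by simp [hc]
      _ ≤ ‖∑ k : Fin n, c k • b k‖ ^ r := hb n _ hdisj
      _ ≤ (n : ℝ) ^ r := by
          gcongr
          exact (norm_sum_le _ _).trans_eq (by simp [hc])
  have hlim : Tendsto (fun n : ℕ => (n : ℝ) ^ (1 - r)) atTop atTop :=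
    (tendsto_rpow_atTop (sub_pos.2 hr1)).comp tendsto_natCast_atTop_atTop
  obtain ⟨n, hn, hn0⟩ :=
    ((hlim.eventually_gt_atTop (C ^ r)⁻¹).and (eventually_gt_atTop 0)).exists
  have hn0' : (0 : ℝ) < n := by exact_mod_cast hn0
  have hlt : (n : ℝ) ^ r < C ^ r * n :=
    calc (n : ℝ) ^ r = C ^ r * ((C ^ r)⁻¹ * (n : ℝ) ^ r) :=
          (mul_inv_cancel_left₀ (by positivity) _).symm
      _ < C ^ r * ((n : ℝ) ^ (1 - r) * (n : ℝ) ^ r) := by gcongr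
      _ = C ^ r * n := by rw [← Real.rpow_add hn0', sub_add_cancel, Real.rpow_one]
  exact hlt.not_ge (hgrowth n)

end UnconditionalBasis

section Gorelik

open Filter Metric Set Topology
open scoped Pointwise

variable {𝕜 X : Type*} [RCLike 𝕜] [NormedAddCommGroup X] [NormedSpace 𝕜 X]

/- The Gorelik principle: the map `a ↦ P (U⁻¹ (U (m + a) + y) - m)` of `V` stays at a bounded
distance from the identity, so it has a zero. -/
theorem exists_isCompact_forall_exists_ker_eq_add {V : Submodule 𝕜 X} [FiniteDimensional 𝕜 V]
    {P : X →L[𝕜] V} (hP : ∀ a : V, P a = a) {Y : Type*} [SeminormedAddCommGroup Y] (U : X ≃ₜ Y)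
    {β d : ℝ} (hU : ∀ y y', ‖y - y'‖ ≤ β → ‖U.symm y - U.symm y'‖ ≤ d) (m : X) :
    ∃ S, IsCompact S ∧ ∀ y, ‖y‖ ≤ β → ∃ k ∈ S, ∃ v,
      P v = 0 ∧ ‖v‖ ≤ (‖P‖ + 1) * d ∧ U (m + v) = k + y := by
  have : ProperSpace V := FiniteDimensional.proper_rclike 𝕜 V
  refine ⟨(fun a : V => U (m + a)) '' closedBall 0 (‖P‖ * d),
    (isCompact_closedBall _ _).image (by fun_prop), fun y hy => ?_⟩
  let v : V → X := fun a => U.symm (U (m + a) + y) - m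
  have hv : Continuous v := by fun_prop
  have hdist : ∀ a, ‖v a - a‖ ≤ d := fun a => by
    simpa [v, sub_sub] using hU (U (m + a) + y) (U (m + a)) (by simpa using hy)
  have hPdist : ∀ a, ‖P (v a) - a‖ ≤ ‖P‖ * d := by
    intro a
    rw [← hP a, ← map_sub, hP a]
    exact P.le_of_opNorm_le_of_le le_rfl (hdist a)
  obtain ⟨a, ha⟩ := exists_eq_zero_of_norm_sub_le 𝕜 (P.continuous.comp hv) hPdist
  have ha_norm : ‖a‖ ≤ ‖P‖ * d := by simpa [show P (v a) = 0 from ha] using hPdist a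
  refine ⟨U (m + a), ⟨a, by simpa using ha_norm, rfl⟩, v a, ha, ?_, by simp [v]⟩
  calc ‖v a‖ ≤ ‖v a - a‖ + ‖(a : X)‖ := norm_le_norm_sub_add _ _
    _ ≤ d + ‖P‖ * d := add_le_add (hdist a) ha_norm
    _ = (‖P‖ + 1) * d := by ring

theorem exists_isCompact_forall_exists_tail_eq_add [CompleteSpace X]
    (b : UnconditionalSchauderBasis ℕ 𝕜 X) {Y : Type*} [SeminormedAddCommGroup Y] (U : X ≃ₜ Y)
    (hU : IsCoarseLipschitz U.symm) :
    ∃ Λ > 0, ∀ R ≥ Λ, ∀ m N, ∃ S, IsCompact S ∧ ∀ y, ‖y‖ ≤ R / Λ → ∃ k ∈ S, ∃ v,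
      (∀ i < N, b.coord i v = 0) ∧ ‖v‖ ≤ R ∧ U (m + v) = k + y := by
  obtain ⟨Λ, hΛ, hU⟩ := hU
  obtain ⟨K, hK⟩ := b.exists_norm_proj_le
  have hK0 : 0 ≤ K := (norm_nonneg _).trans (hK ∅)
  refine ⟨(K + 1) * Λ, by positivity, fun R hR m N => ?_⟩
  set β := R / ((K + 1) * Λ) with hβ_def
  have hβ : 1 ≤ β := (one_le_div (by positivity)).2 hR
  have hUβ : ∀ y y', ‖y - y'‖ ≤ β → ‖U.symm y - U.symm y'‖ ≤ Λ * β := by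
    intro y y' hy
    rw [← dist_eq_norm] at hy ⊢
    exact (hU y y').trans (by gcongr; exact max_le hβ hy)
  have : FiniteDimensional 𝕜 (b.proj (Finset.range N)).toLinearMap.range := by
    rw [b.range_proj_eq_span]
    exact FiniteDimensional.span_of_finite 𝕜 (Set.toFinite _)
  set V := (b.proj (Finset.range N)).toLinearMap.range
  let P : X →L[𝕜] V := (b.proj (Finset.range N)).codRestrict V fun x => ⟨x, rfl⟩
  have hP : ∀ a : V, P a = a := by
    rintro ⟨_, x, rfl⟩
    have hidem : b.proj (Finset.range N) (b.proj (Finset.range N) x) =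
        b.proj (Finset.range N) x := by
      simp only [b.proj_comp, Finset.inter_self]
    exact Subtype.ext hidem
  have hPK : ‖P‖ ≤ K := P.opNorm_le_bound hK0 fun x => (b.proj _).le_of_opNorm_le (hK _) x
  obtain ⟨S, hS, hUS⟩ := exists_isCompact_forall_exists_ker_eq_add hP U hUβ m
  refine ⟨S, hS, fun y hy => ?_⟩
  obtain ⟨k, hk, v, hPv, hv, hUv⟩ := hUS y hy
  refine ⟨k, hk, v, fun i => coord_eq_zero_of_proj_range_eq_zero b (congrArg Subtype.val hPv),
    ?_, hUv⟩
  calc ‖v‖ ≤ (‖P‖ + 1) * (Λ * β) := hv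
    _ ≤ (K + 1) * (Λ * β) := by gcongr
    _ = R := by rw [← mul_assoc, hβ_def, mul_div_cancel₀ _ (by positivity)]

/- A multiple of `z j` with `j` large is almost disjoint from any given compact set, so this follows
from the Gorelik principle. -/
theorem exists_forall_le_norm_proj_singleton [CompleteSpace X] {𝕜' Y Z : Type*} [RCLike 𝕜']
    [NormedAddCommGroup Y] [NormedSpace 𝕜' Y] [CompleteSpace Y] [NormedAddCommGroup Z]
    [NormedSpace 𝕜' Z] [CompleteSpace Z] (b : UnconditionalSchauderBasis ℕ 𝕜 X)
    (z : UnconditionalSchauderBasis ℕ 𝕜' Z) (U : X ≃ₜ Y) (hU : IsCoarseLipschitz U.symm)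
    {q : Y →L[𝕜'] Z} (hq : Function.Surjective q) :
    ∃ κ > 0, ∃ R₀, ∀ R ≥ R₀, ∀ m N N' (S : Set Z), IsCompact S →
      ∃ v, (∀ i < N, b.coord i v = 0) ∧ ‖v‖ ≤ R ∧
        ∃ j ≥ N', ∀ y ∈ S, κ * R ≤ ‖z.proj {j} (q (U (m + v)) - y)‖ := by
  obtain ⟨Λ, hΛ, hU⟩ := exists_isCompact_forall_exists_tail_eq_add b U hU
  obtain ⟨c, hc, hq⟩ := q.exists_preimage_norm_le hq
  obtain ⟨K, hK⟩ := z.exists_norm_proj_le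
  refine ⟨1 / (2 * c * Λ), by positivity, Λ, fun R hR m N N' S hS => ?_⟩
  obtain ⟨T, hT, hUT⟩ := hU R hR m N
  have hR0 : 0 < R := hΛ.trans_le hR
  have hTS : IsCompact (q '' T - S) := by
    rw [sub_eq_add_neg]
    exact (hT.image q.continuous).add hS.neg
  have hsmall := Metric.tendstoUniformlyOn_iff.1 (tendstoUniformlyOn_zero_of_isCompact
    (fun j => hK {j}) (tendsto_proj_singleton z) hTS) (R / Λ / (2 * c)) (by positivity)
  obtain ⟨j, hj, hjN'⟩ := (hsmall.and (eventually_ge_atTop N')).exists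
  obtain ⟨a, ha⟩ := exists_norm_smul_basis_eq z j (show 0 ≤ R / Λ / c by positivity)
  obtain ⟨y, hqy, hy⟩ := hq (a • z j)
  obtain ⟨k, hk, v, hvN, hv, hUv⟩ := hUT y (hy.trans_eq (by rw [ha, mul_div_cancel₀ _ hc.ne']))
  refine ⟨v, hvN, hv, j, hjN', fun s hs => ?_⟩
  have hks : ‖z.proj {j} (q k - s)‖ < R / Λ / (2 * c) := by
    simpa using hj _ (sub_mem_sub (mem_image_of_mem q hk) hs)
  have hproj : z.proj {j} (q (U (m + v)) - s) = a • z j + z.proj {j} (q k - s) := by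
    rw [hUv, map_add, add_sub_right_comm, hqy, map_add, add_comm, map_smul,
      z.proj_apply_basis_mem, if_pos (Finset.mem_singleton_self j)]
  calc 1 / (2 * c * Λ) * R = R / Λ / c - R / Λ / (2 * c) := by field_simp; norm_num
    _ ≤ ‖a • z j‖ - ‖z.proj {j} (q k - s)‖ := by rw [ha]; gcongr
    _ ≤ ‖z.proj {j} (q (U (m + v)) - s)‖ := hproj ▸ norm_sub_le_norm_add _ _

end Gorelik

section BlockLipschitz

open Filter Function Set Topology
open UnconditionalSchauderBasis (DisjointlySupported HasUpperEstimate HasLowerEstimate)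

variable {𝕜 𝕜' X Z : Type*} [RCLike 𝕜] [RCLike 𝕜'] [NormedAddCommGroup X] [NormedSpace 𝕜 X]
  [NormedAddCommGroup Z] [NormedSpace 𝕜' Z]

/-- `F` is `L`-Lipschitz at scales at least `s` when displacements are measured by the `ℓ^p`-sum
of disjointly supported summands with respect to `b`, and increments of `F` by the `ℓ^r`-sums of
their projections on disjoint finite blocks of `z`. The midpoint argument is applied to the almost
optimal constant `L` of this kind. -/
def IsBlockLipschitz (b : UnconditionalSchauderBasis ℕ 𝕜 X)
    (z : UnconditionalSchauderBasis ℕ 𝕜' Z) (p r : ℝ) (F : X → Z) (s L : ℝ) : Prop :=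
  ∀ (x : X) (n : ℕ) (u : Fin n → X), DisjointlySupported b u → s ≤ lpSum p u →
    ∀ (m : ℕ) (A : Fin m → Finset ℕ), Pairwise (Disjoint on A) →
      lpSum r (fun k => z.proj (A k) (F (x + ∑ i, u i) - F x)) ≤ L * lpSum p u

variable {b : UnconditionalSchauderBasis ℕ 𝕜 X} {z : UnconditionalSchauderBasis ℕ 𝕜' Z} {p r : ℝ}
  {F : X → Z} {s L : ℝ}

theorem IsBlockLipschitz.mono {s' : ℝ} (hF : IsBlockLipschitz b z p r F s L) (hs : s ≤ s') :
    IsBlockLipschitz b z p r F s' L :=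
  fun x n u hu hsu => hF x n u hu (hs.trans hsu)

theorem exists_isBlockLipschitz [CompleteSpace Z] (hp : 0 < p) (hr : 0 < r)
    (hb : HasUpperEstimate b p) (hz : HasLowerEstimate z r) (hF : IsCoarseLipschitz F) :
    ∃ L > 0, IsBlockLipschitz b z p r F 1 L := by
  obtain ⟨C, hC, hb⟩ := exists_norm_sum_le_mul_lpSum hp hb
  obtain ⟨D, hD, hz⟩ := exists_lpSum_proj_le_mul_norm hr hz
  obtain ⟨Λ, hΛ, hF⟩ := hF
  refine ⟨D * (Λ * (C + 1)), by positivity, fun x n u hu h1 m A hA => ?_⟩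
  have hmax : max 1 ‖∑ i, u i‖ ≤ (C + 1) * lpSum p u := by
    refine max_le ?_ ((hb n u hu).trans ?_) <;> nlinarith
  calc lpSum r (fun k => z.proj (A k) (F (x + ∑ i, u i) - F x))
      ≤ D * ‖F (x + ∑ i, u i) - F x‖ := hz m A hA _
    _ ≤ D * (Λ * max 1 ‖∑ i, u i‖) := by
        gcongr
        simpa [dist_eq_norm] using hF (x + ∑ i, u i) x
    _ ≤ D * (Λ * ((C + 1) * lpSum p u)) := by gcongr
    _ = D * (Λ * (C + 1)) * lpSum p u := by ring

theorem IsBlockLipschitz.norm_proj_singleton_le (hp : p ≠ 0) (hr : r ≠ 0)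
    (hF : IsBlockLipschitz b z p r F s L) (x : X) {v : X} (hv : s ≤ ‖v‖) (j : ℕ) :
    ‖z.proj {j} (F (x + v) - F x)‖ ≤ L * ‖v‖ := by
  simpa [lpSum_of_unique hp, lpSum_of_unique hr] using
    hF x 1 (fun _ => v) (disjointlySupported_of_forall_notMem (A := fun _ => univ)
      Subsingleton.pairwise fun _ i hi => absurd (mem_univ i) hi)
      (by rwa [lpSum_of_unique hp]) 1 (fun _ => {j}) Subsingleton.pairwise

theorem exists_truncation_of_not_isBlockLipschitz (hp : 0 < p) (hr : 0 < r) (hF : Continuous F)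
    (hs : 0 < s) (h : ¬ IsBlockLipschitz b z p r F (3 * s) L) :
    ∃ (x : X) (n : ℕ) (u : Fin n → X) (N : ℕ), DisjointlySupported b u ∧
      (∀ k, ∀ i ≥ N, b.coord i (u k) = 0) ∧ s ≤ lpSum p u ∧
      ∃ (m : ℕ) (A : Fin m → Finset ℕ), Pairwise (Disjoint on A) ∧
        2 * (L * lpSum p u) <
          lpSum r fun k => z.proj (A k) (F (x + (∑ i, u i + ∑ i, u i)) - F x) := by
  unfold IsBlockLipschitz at h
  push Not at h
  obtain ⟨x, n, u, hu, hsu, m, A, hA, hlt⟩ := h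
  let h : Fin n → X := fun k => (2⁻¹ : 𝕜) • u k
  have hh : ∑ i, h i + ∑ i, h i = ∑ i, u i := by
    rw [← Finset.smul_sum, ← add_smul, show (2⁻¹ : 𝕜) + 2⁻¹ = 1 by norm_num, one_smul]
  have hhp : lpSum p h = 2⁻¹ * lpSum p u := by rw [lpSum_smul hp.ne']; simp
  have hlim : Tendsto (fun N k => b.proj (Finset.range N) (h k)) atTop (𝓝 h) :=
    tendsto_pi_nhds.2 fun k => tendsto_proj_range b (h k)
  have hcont : Continuous fun w : Fin n → X =>
      lpSum r fun k => z.proj (A k) (F (x + (∑ i, w i + ∑ i, w i)) - F x) :=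
    (continuous_lpSum hr).comp (by fun_prop)
  have hsmall := hlim.eventually <| (isOpen_lt
    (continuous_const.mul (continuous_const.mul (continuous_lpSum hp))) hcont).mem_nhds
      (show 2 * (L * lpSum p h) < _ by rw [hh, hhp]; linarith)
  have hlarge := hlim.eventually <| (isOpen_lt continuous_const (continuous_lpSum hp)).mem_nhds
    (show s < lpSum p h by rw [hhp]; linarith)
  obtain ⟨N, hN, hsN⟩ := (hsmall.and hlarge).exists
  refine ⟨x, n, fun k => b.proj (Finset.range N) (h k), N,
    disjointlySupported_proj (disjointlySupported_smul hu _) _, fun k i hi => ?_, hsN.le, m, A, hA,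
    hN⟩
  rw [basis_coord_proj, if_neg (by simpa using hi)]

theorem IsBlockLipschitz.norm_proj_le (hp : 0 < p) (hr : 0 < r) {θ σ ε : ℝ} (hθ : 0 ≤ θ)
    (hσ : 0 ≤ σ) (hε : 0 ≤ ε) (hL : 0 ≤ L) (hF : IsBlockLipschitz b z p r F s (θ * L))
    (hθσ : (θ * (1 + σ ^ p) ^ (1 / p)) ^ r ≤ 1 + ε ^ r) {n N : ℕ} {u : Fin n → X}
    (hu : DisjointlySupported b u) (huN : ∀ k, ∀ i ≥ N, b.coord i (u k) = 0)
    (hs : s ≤ lpSum p u) {v : X} (hvN : ∀ i < N, b.coord i v = 0) (hv : ‖v‖ ≤ σ * lpSum p u)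
    {m : ℕ} {A : Fin m → Finset ℕ} (hA : Pairwise (Disjoint on A)) {B : Finset ℕ}
    (hB : ∀ k, Disjoint B (A k)) {x : X}
    (hx : L * lpSum p u ≤ lpSum r fun k => z.proj (A k) (F (x + (v + ∑ i, u i)) - F x)) :
    ‖z.proj B (F (x + (v + ∑ i, u i)) - F x)‖ ≤ ε * (L * lpSum p u) := by
  have hT : 0 ≤ lpSum p u := lpSum_nonneg p u
  have hF' := hF x (n + 1) (Fin.cons v u) (disjointlySupported_cons hu huN hvN)
    (hs.trans (lpSum_le_lpSum_cons hp v u)) (m + 1) (Fin.cons B A)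
    (pairwise_fin_succ_iff_of_isSymm.2 ⟨hB, hA⟩)
  rw [Fin.sum_cons] at hF'
  set ζ := F (x + (v + ∑ i, u i)) - F x
  have hcons : (fun k => z.proj ((Fin.cons B A : Fin (m + 1) → Finset ℕ) k) ζ) =
      Fin.cons (z.proj B ζ) fun k => z.proj (A k) ζ :=
    funext <| Fin.cases rfl fun _ => rfl
  have hbound : ‖z.proj B ζ‖ ^ r + (L * lpSum p u) ^ r ≤
      (1 + ε ^ r) * (L * lpSum p u) ^ r :=
    calc ‖z.proj B ζ‖ ^ r + (L * lpSum p u) ^ r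
        ≤ ‖z.proj B ζ‖ ^ r + lpSum r (fun k => z.proj (A k) ζ) ^ r := by gcongr
      _ = lpSum r (fun k => z.proj ((Fin.cons B A : Fin (m + 1) → Finset ℕ) k) ζ) ^ r := by
          rw [hcons, lpSum_cons_rpow hr.ne']
      _ ≤ (θ * L * ((1 + σ ^ p) ^ (1 / p) * lpSum p u)) ^ r := by
          refine Real.rpow_le_rpow (lpSum_nonneg _ _) (hF'.trans ?_) hr.le
          gcongr
          exact lpSum_cons_le hp hσ hv
      _ = (θ * (1 + σ ^ p) ^ (1 / p)) ^ r * (L * lpSum p u) ^ r := by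
          rw [← Real.mul_rpow (by positivity) (by positivity)]
          ring_nf
      _ ≤ (1 + ε ^ r) * (L * lpSum p u) ^ r := by gcongr
  rw [← Real.rpow_le_rpow_iff (norm_nonneg _) (by positivity) hr,
    Real.mul_rpow hε (by positivity)]
  linarith

/- If the constant `L` is nearly attained on `(x, x')`, it is nearly attained on `(x, w)` or on
`(w, x')` for each approximate midpoint `w = m + v`. The blocks witnessing this exhaust the estimate
for the increment of `F`, so its far coordinates are small. -/
theorem exists_approximate_midpoint (hp : 0 < p) (hr : 1 ≤ r) (hF : Continuous F) (hs : 0 < s)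
    (hL : 0 ≤ L) {θ σ ε : ℝ} (hθ : 0 ≤ θ) (hσ : 0 ≤ σ) (hε : 0 ≤ ε)
    (hθσ : (θ * (1 + σ ^ p) ^ (1 / p)) ^ r ≤ 1 + ε ^ r)
    (hF_θL : IsBlockLipschitz b z p r F s (θ * L))
    (hF_L : ¬ IsBlockLipschitz b z p r F (3 * s) L) :
    ∃ (m : X) (N N' : ℕ) (τ : ℝ) (y₁ y₂ : Z), s ≤ τ ∧
      ∀ v, (∀ i < N, b.coord i v = 0) → ‖v‖ ≤ σ * τ →
        ∃ y ∈ ({y₁, y₂} : Set Z), ∀ j ≥ N', ‖z.proj {j} (F (m + v) - y)‖ ≤ ε * (L * τ) := by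
  have hr0 : 0 < r := one_pos.trans_le hr
  obtain ⟨x, n, u, N, hu, huN, hsu, l, A, hA, hlt⟩ :=
    exists_truncation_of_not_isBlockLipschitz hp hr0 hF hs hF_L
  set t := ∑ i, u i
  set x' := x + (t + t)
  have hdisj : ∀ j ≥ (Finset.univ.biUnion A).sup id + 1, ∀ k, Disjoint {j} (A k) := by
    intro j hj k
    refine Finset.disjoint_singleton_left.2 fun hjk => (Nat.lt_of_succ_le hj).not_ge ?_
    exact Finset.le_sup (f := id) (Finset.mem_biUnion.2 ⟨k, Finset.mem_univ k, hjk⟩)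
  refine ⟨x + t, N, (Finset.univ.biUnion A).sup id + 1, lpSum p u, F x, F x', hsu,
    fun v hvN hv => ?_⟩
  set w := x + t + v
  have hw : x + (v + t) = w := by simp only [w]; abel
  have hwx' : w + (-v + t) = x' := by simp only [w, x']; abel
  have hmink : lpSum r (fun k => z.proj (A k) (F x' - F x)) ≤
      lpSum r (fun k => z.proj (A k) (F w - F x)) +
        lpSum r fun k => z.proj (A k) (F x' - F w) := by
    refine le_of_eq_of_le ?_ (lpSum_add_le hr _ _)
    simp only [← map_add, sub_add_sub_cancel']
  rcases le_or_gt (L * lpSum p u) (lpSum r fun k => z.proj (A k) (F w - F x)) with hxw | hxw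
  · refine ⟨F x, mem_insert _ _, fun j hj => ?_⟩
    rw [← hw] at hxw ⊢
    exact hF_θL.norm_proj_le hp hr0 hθ hσ hε hL hθσ hu huN hsu hvN hv hA (hdisj j hj) hxw
  · refine ⟨F x', mem_insert_of_mem _ rfl, fun j hj => ?_⟩
    have hwx : L * lpSum p u ≤ lpSum r fun k => z.proj (A k) (F x' - F w) := by linarith
    rw [← neg_sub, map_neg, norm_neg]
    rw [← hwx'] at hwx ⊢
    exact hF_θL.norm_proj_le hp hr0 hθ hσ hε hL hθσ hu huN hsu
      (fun i hi => by rw [map_neg, hvN i hi, neg_zero]) (by rwa [norm_neg]) hA (hdisj j hj) hwx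

end BlockLipschitz

section LinearQuotients

open Function
open UnconditionalSchauderBasis (HasUpperEstimate HasLowerEstimate)

variable {𝕜 𝕜' X Y Z : Type*} [RCLike 𝕜] [RCLike 𝕜']
  [NormedAddCommGroup X] [NormedSpace 𝕜 X] [CompleteSpace X]
  [NormedAddCommGroup Y] [NormedSpace 𝕜' Y] [CompleteSpace Y]
  [NormedAddCommGroup Z] [NormedSpace 𝕜' Z] [CompleteSpace Z]
  {b : UnconditionalSchauderBasis ℕ 𝕜 X} {z : UnconditionalSchauderBasis ℕ 𝕜' Z} {p r : ℝ}
  {U : X ≃ₜ Y} {q : Y →L[𝕜'] Z}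

theorem exists_pos_forall_isBlockLipschitz_le (b : UnconditionalSchauderBasis ℕ 𝕜 X)
    (z : UnconditionalSchauderBasis ℕ 𝕜' Z) (hp : p ≠ 0) (hr : r ≠ 0) (hU : IsCoarseLipschitz U)
    (hU_symm : IsCoarseLipschitz U.symm) (hq : Surjective q) :
    ∃ κ > 0, ∀ s L, 0 < L → IsBlockLipschitz b z p r (q ∘ U) s L → κ ≤ L := by
  obtain ⟨κ, hκ, R₀, hfar⟩ := exists_forall_le_norm_proj_singleton b z U hU_symm hq
  obtain ⟨Λ, hΛ, hF⟩ := hU.lipschitzWith_comp q.lipschitz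
  obtain ⟨K, hK⟩ := z.exists_norm_proj_le
  have hK0 : 0 ≤ K := (norm_nonneg _).trans (hK ∅)
  refine ⟨κ, hκ, fun s L hL hblock => ?_⟩
  obtain ⟨R, ⟨hR₀, hR⟩, hR0⟩ := (((Filter.eventually_ge_atTop R₀).and
    (Filter.eventually_gt_atTop (K * (Λ * max 1 s) / κ))).and
      (Filter.eventually_gt_atTop 0)).exists
  rw [div_lt_iff₀' hκ] at hR
  obtain ⟨v, -, hvR, j, -, hj⟩ := hfar R hR₀ 0 0 0 {q (U 0)} isCompact_singleton
  specialize hj _ rfl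
  have hsv : s ≤ ‖v‖ := by
    by_contra! hvs
    refine hR.not_ge ?_
    calc κ * R ≤ ‖z.proj {j} (q (U (0 + v)) - q (U 0))‖ := hj
      _ ≤ K * ‖q (U (0 + v)) - q (U 0)‖ := (z.proj {j}).le_of_opNorm_le (hK _) _
      _ ≤ K * (Λ * max 1 ‖v‖) := by
          gcongr
          simpa [dist_eq_norm] using hF (0 + v) 0
      _ ≤ K * (Λ * max 1 s) := by gcongr
  have hLR : κ * R ≤ L * R :=
    calc κ * R ≤ ‖z.proj {j} (q (U (0 + v)) - q (U 0))‖ := hj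
      _ ≤ L * ‖v‖ := hblock.norm_proj_singleton_le hp hr 0 hsv j
      _ ≤ L * R := by gcongr
  exact le_of_mul_le_mul_right hLR hR0

theorem not_hasLowerEstimate_of_one_le (hr : 1 ≤ r) (hrp : r < p) (hb : HasUpperEstimate b p)
    (hU : IsCoarseLipschitz U) (hU_symm : IsCoarseLipschitz U.symm) (hq : Surjective q) :
    ¬ HasLowerEstimate z r := by
  intro hz
  have hr0 : 0 < r := one_pos.trans_le hr
  have hp : 0 < p := hr0.trans hrp
  obtain ⟨L', hL', hblock⟩ :=
    exists_isBlockLipschitz hp hr0 hb hz (hU.lipschitzWith_comp q.lipschitz)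
  obtain ⟨κ₀, hκ₀, hlower⟩ :=
    exists_pos_forall_isBlockLipschitz_le b z hp.ne' hr0.ne' hU hU_symm hq
  obtain ⟨κ, hκ, R₀, hfar⟩ := exists_forall_le_norm_proj_singleton b z U hU_symm hq
  obtain ⟨σ, hσ, θ, hθ, hθσ⟩ :=
    exists_rpow_le_one_add_rpow hr0 hrp (show 0 < κ / (2 * L') by positivity)
  obtain ⟨L, hL, hLL', ⟨s₀, hs₀⟩, hnot⟩ := exists_pos_mul_and_not_of_forall_le
    (P := fun L => ∃ s, IsBlockLipschitz b z p r (q ∘ U) s L) hκ₀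
    (fun L hL ⟨s, hs⟩ => hlower s L hL hs) hθ hL' ⟨1, hblock⟩
  let s := max s₀ (max 1 (R₀ / σ))
  have hs : 0 < s := one_pos.trans_le (le_max_of_le_right (le_max_left _ _))
  obtain ⟨m, N, N', τ, y₁, y₂, hτ, hmid⟩ := exists_approximate_midpoint hp hr
    (q.continuous.comp U.continuous) hs hL.le (one_pos.trans hθ).le hσ.le (by positivity) hθσ
    (hs₀.mono (le_max_left _ _)) fun h => hnot ⟨_, h⟩
  have hR₀ : R₀ ≤ σ * τ :=
    (div_le_iff₀' hσ).1 ((le_max_of_le_right (le_max_right _ _)).trans hτ)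
  obtain ⟨v, hvN, hv, j, hj, hfar_j⟩ := hfar (σ * τ) hR₀ m N N' {y₁, y₂}
    (Set.toFinite _).isCompact
  obtain ⟨y, hy, hmid_y⟩ := hmid v hvN hv
  have hστ : 0 < κ * (σ * τ) := mul_pos hκ (mul_pos hσ (hs.trans_le hτ))
  have hle : κ * (σ * τ) ≤ κ * (σ * τ) / 2 :=
    calc κ * (σ * τ) ≤ ‖z.proj {j} (q (U (m + v)) - y)‖ := hfar_j y hy
      _ ≤ κ / (2 * L') * σ * (L * τ) := hmid_y j hj
      _ = κ * (σ * τ) / 2 * (L / L') := by field_simp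
      _ ≤ κ * (σ * τ) / 2 := mul_le_of_le_one_right (by positivity) ((div_le_one hL').2 hLL')
  linarith

theorem theorem1p4_general (hr : 0 < r) (hrp : r < p) (hb : HasUpperEstimate b p)
    (hU : IsCoarseLipschitz U) (hU_symm : IsCoarseLipschitz U.symm) (hq : Surjective q) :
    ¬ HasLowerEstimate z r := by
  rcases lt_or_ge r 1 with hr1 | hr1
  · exact not_hasLowerEstimate_of_lt_one z hr hr1
  · exact not_hasLowerEstimate_of_one_le hr1 hrp hb hU hU_symm hq

end LinearQuotients

theorem theorem1p4 {𝕜 : Type*} [RCLike 𝕜]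
    {X : Type*} [NormedAddCommGroup X] [NormedSpace 𝕜 X] [CompleteSpace X]
    {Y : Type*} [NormedAddCommGroup Y] [NormedSpace 𝕜 Y] [CompleteSpace Y]
    (p : ℝ) (hp : 0 < p)
    (hX : ∃ b : UnconditionalSchauderBasis ℕ 𝕜 X,
      UnconditionalSchauderBasis.HasUpperEstimate b p)
    (hXY : Nonempty (X ≃ᵤ Y))
    (M : Submodule 𝕜 Y) [IsClosed (M : Set Y)]
    (r : ℝ) (hr : 0 < r) (hrp : r < p) :
    ¬ ∃ z : UnconditionalSchauderBasis ℕ 𝕜 (Y ⧸ M),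
      UnconditionalSchauderBasis.HasLowerEstimate z r := by
  obtain ⟨b, hb⟩ := hX
  obtain ⟨U⟩ := hXY
  rintro ⟨z, hz⟩
  exact theorem1p4_general (U := U.toHomeomorph) hr hrp hb
    (isCoarseLipschitz_of_uniformContinuous 𝕜 U.uniformContinuous)
    (isCoarseLipschitz_of_uniformContinuous 𝕜 U.symm.uniformContinuous) (q := M.mkQL)
    M.mkQ_surjective hz
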